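/- Let $0<H<1$, $0<K\le 1$ and $T>0$. Let $W^{H,K}=\{W^{H,K}_t,\ 0\le t\le T\}$ be a bifractional Brownian motion with parameters $H,K$, i.e. a centered Gaussian process with covariance $$E[W^{H,K}_sW^{H,K}_t]=\frac1{2^K}\left[(t^{2H}+s^{2H})^K-|s-t|^{2HK}\right],$$ let $W^{HK}=\{W^{HK}_t,\ 0\le t\le T\}$ be a fractional Brownian motion with Hurst index $HK$, i.e. a centered Gaussian process with covariance $$E[W^{HK}_sW^{HK}_t]=\frac12\left(t^{2HK}+s^{2HK}-|t-s|^{2HK}\right),$$ and put $Y^{(1)}_t=2^{(1-K)/2}\,W^{HK}_t$. Assume that $W^{H,K}$ and $W^{HK}$ have almost surely continuous sample paths on $[0,T]$ (they need not be defined on the same probability space). Then for every non-decreasing convex function $g:[0,\infty)\to\mathbb R$, $$E\Big[g\Big(\sup_{0\le s,t\le T}(W^{H,K}_t-W^{H,K}_s)\Big)\Big]\le E\Big[g\Big(\sup_{0\le s,t\le T}(Y^{(1)}_t-Y^{(1)}_s)\Big)\Big],$$ where both expectations exist as extended real numbers. Moreover $\sup_{0\le t\le T}W^{H,K}_t$ and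 $\sup_{0\le t\le T}Y^{(1)}_t$ are integrable and $$E\Big[\sup_{0\le t\le T}W^{H,K}_t\Big]\le E\Big[\sup_{0\le t\le T}Y^{(1)}_t\Big].$$ -/

import Mathlib

open MeasureTheory ProbabilityTheory Set
open scoped ENNReal

/-- The covariance function of fractional Brownian motion with Hurst index `H`. -/
noncomputable def fbmCov (H s t : ℝ) : ℝ :=
  (1 / 2) * (t ^ (2 * H) + s ^ (2 * H) - |t - s| ^ (2 * H))

/-- The covariance function of bifractional Brownian motion with parameters `H` and `K`. -/
noncomputable def bifbmCov (H K s t : ℝ) : ℝ :=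
  (1 / (2 : ℝ) ^ K) * ((t ^ (2 * H) + s ^ (2 * H)) ^ K - |s - t| ^ (2 * H * K))

/-- `B` is a fractional Brownian motion with Hurst index `H` on the time interval `[0, T]`:
a centered Gaussian process with covariance `fbmCov H`. -/
structure IsFractionalBM {Ω : Type*} [MeasurableSpace Ω] (P : Measure Ω) (H T : ℝ)
    (B : Icc (0 : ℝ) T → Ω → ℝ) : Prop where
  gaussian : IsGaussianProcess B P
  centered : ∀ t, ∫ ω, B t ω ∂P = 0
  covariance_eq : ∀ s t, covariance (B s) (B t) P = fbmCov H s t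

/-- `W` is a bifractional Brownian motion with parameters `H` and `K` on the time interval
`[0, T]`: a centered Gaussian process with covariance `bifbmCov H K`. -/
structure IsBifractionalBM {Ω : Type*} [MeasurableSpace Ω] (P : Measure Ω) (H K T : ℝ)
    (W : Icc (0 : ℝ) T → Ω → ℝ) : Prop where
  gaussian : IsGaussianProcess W P
  centered : ∀ t, ∫ ω, W t ω ∂P = 0
  covariance_eq : ∀ s t, covariance (W s) (W t) P = bifbmCov H K s t

/-- Almost every sample path is continuous on `[0, T]`. -/
def HasContinuousPaths {Ω : Type*} [MeasurableSpace Ω] (P : Measure Ω) {T : ℝ}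
    (X : Icc (0 : ℝ) T → Ω → ℝ) : Prop :=
  ∀ᵐ ω ∂P, Continuous fun t => X t ω

/-- The process `2 ^ ((1 - K) / 2) • B`. -/
noncomputable def scaledProcess {Ω : Type*} (K : ℝ) {T : ℝ} (B : Icc (0 : ℝ) T → Ω → ℝ) :
    Icc (0 : ℝ) T → Ω → ℝ :=
  fun t ω => (2 : ℝ) ^ ((1 - K) / 2) * B t ω

/-- The supremum `sup_{0 ≤ t ≤ T} X_t`. -/
noncomputable def supProcess {Ω : Type*} {T : ℝ} (X : Icc (0 : ℝ) T → Ω → ℝ) (ω : Ω) : ℝ :=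
  ⨆ t : Icc (0 : ℝ) T, X t ω

/-- The supremum of increments `sup_{0 ≤ t, s ≤ T} (X_t - X_s)`. -/
noncomputable def supIncrement {Ω : Type*} {T : ℝ} (X : Icc (0 : ℝ) T → Ω → ℝ) (ω : Ω) : ℝ :=
  ⨆ p : Icc (0 : ℝ) T × Icc (0 : ℝ) T, (X p.1 ω - X p.2 ω)

/-- The expectation of `f` exists as an extended real number: `f` is a random variable
(up to null sets) whose positive or negative part has finite expectation. -/
def HasExtExpectation {Ω : Type*} [MeasurableSpace Ω] (P : Measure Ω) (f : Ω → ℝ) : Prop :=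
  AEMeasurable f P ∧
    (∫⁻ ω, ENNReal.ofReal (f ω) ∂P ≠ ∞ ∨ ∫⁻ ω, ENNReal.ofReal (-f ω) ∂P ≠ ∞)

/-- The expectation of `f` in the extended reals, `E[f⁺] - E[f⁻]`. -/
noncomputable def extExpectation {Ω : Type*} [MeasurableSpace Ω] (P : Measure Ω) (f : Ω → ℝ) :
    EReal :=
  ((∫⁻ ω, ENNReal.ofReal (f ω) ∂P : ℝ≥0∞) : EReal) -
    ((∫⁻ ω, ENNReal.ofReal (-f ω) ∂P : ℝ≥0∞) : EReal)

/-! With `x = s ^ (2H)` and `y = t ^ (2H)`, the covariance of `Y` minus that of `W` is `2 ^ (-K) *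
(x ^ K + y ^ K - (x + y) ^ K)`, because the terms in `|t - s|` cancel. This kernel is positive
semidefinite. For `K < 1`, the power `x ^ K` is a positive multiple of the integral of `(1 - exp
(-xθ)) θ ^ (-1 - K)` over `θ > 0`, and substituting this into the kernel turns the bracket into the
product `(1 - exp (-xθ)) (1 - exp (-yθ))`, so every quadratic form is an integral of squares
(`sum_sum_rpow_add_rpow_sub_nonneg`).

Hence at finitely many times `Y` has the law of `W + Z` with `Z` an independent centered Gaussian
vector. Since `W + Z` and `W - Z` have the same law, midpoint convexity gives `E f(W) ≤ E f(Y)` for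
convex `f ≥ 0` (`lintegral_le_of_covariance_sub_posSemidef`). A maximum of coordinates is convex,
and remains so after composition with an increasing convex function; monotone convergence along a
dense sequence of times reaches the full supremum (`CovarianceDominated.lintegral_iSup_le`).
Increments are linear in the process, so they inherit the domination.

Integrability of the suprema follows from Fernique's theorem with a bound free of the dimension
(`lintegral_iSup_ne_top`). Both processes vanish almost surely at time `0`, so their suprema are
nonnegative and only positive parts matter. -/

/-! ### Convex comparison of finite Gaussian vectors. -/

/-- The variance of a linear form on a finite product, in terms of the covariances of the
coordinates. -/
theorem variance_strongDual_pi {ι Ω : Type*} [Fintype ι] [DecidableEq ι] [MeasurableSpace Ω]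
    {P : Measure Ω} {X : ι → Ω → ℝ} (hX : HasGaussianLaw (fun ω i => X i ω) P)
    (L : StrongDual ℝ (ι → ℝ)) :
    Var[L; P.map (fun ω i => X i ω)] =
      ∑ i, ∑ j, L (Pi.single i 1) * L (Pi.single j 1) * cov[X i, X j; P] := by
  have := hX.isProbabilityMeasure
  have hL : ∀ x : ι → ℝ, L x = ∑ i, L (Pi.single i 1) * x i := by
    intro x
    conv_lhs => rw [pi_eq_sum_univ' x, map_sum]
    simp [mul_comm]
  rw [variance_map (by fun_prop) hX.aemeasurable]
  have h2 : ∀ i, MemLp (fun ω => L (Pi.single i 1) * X i ω) 2 P :=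
    fun i => ((hX.eval i).memLp_two).const_mul _
  have : (L ∘ fun ω i => X i ω) = fun ω => ∑ i, L (Pi.single i 1) * X i ω := by
    exact funext fun ω => hL _
  rw [this, variance_fun_sum h2]
  refine Finset.sum_congr rfl fun i _ => Finset.sum_congr rfl fun j _ => ?_
  rw [covariance_const_mul_left, covariance_const_mul_right, mul_assoc]

theorem integral_id_map_eq_zero {ι Ω : Type*} [Fintype ι] [MeasurableSpace Ω]
    {P : Measure Ω} {X : ι → Ω → ℝ} (hX : HasGaussianLaw (fun ω i => X i ω) P)
    (hX0 : ∀ i, ∫ ω, X i ω ∂P = 0) : ∫ x, id x ∂(P.map (fun ω i => X i ω)) = 0 := by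
  rw [integral_map hX.aemeasurable (by fun_prop)]
  ext i
  simp only [id]
  rw [eval_integral (fun i => (hX.eval i).integrable)]
  exact hX0 i

/-- Two centered Gaussian vectors with the same covariances have the same law. -/
theorem map_eq_of_covariance_eq {ι Ω Ω' : Type*} [Fintype ι] [MeasurableSpace Ω]
    [MeasurableSpace Ω'] {P : Measure Ω} {P' : Measure Ω'} {X : ι → Ω → ℝ} {Y : ι → Ω' → ℝ}
    (hX : HasGaussianLaw (fun ω i => X i ω) P) (hY : HasGaussianLaw (fun ω i => Y i ω) P')
    (hX0 : ∀ i, ∫ ω, X i ω ∂P = 0) (hY0 : ∀ i, ∫ ω, Y i ω ∂P' = 0)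
    (h : ∀ i j, cov[X i, X j; P] = cov[Y i, Y j; P']) :
    P.map (fun ω i => X i ω) = P'.map (fun ω i => Y i ω) := by
  have := hX.isGaussian_map
  have := hY.isGaussian_map
  classical
  apply Measure.ext_of_charFunDual
  ext L
  rw [IsGaussian.charFunDual_eq_of_integral_eq_zero (integral_id_map_eq_zero hX hX0),
    IsGaussian.charFunDual_eq_of_integral_eq_zero (integral_id_map_eq_zero hY hY0),
    variance_strongDual_pi hX, variance_strongDual_pi hY]
  simp only [h]

/-- If the difference of the covariance matrices of two centered Gaussian vectors is positive
semidefinite then the vectors are comparable in the convex order. -/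
theorem lintegral_le_of_covariance_sub_posSemidef {ι Ω Ω' : Type*} [Fintype ι] [MeasurableSpace Ω]
    [MeasurableSpace Ω'] {P : Measure Ω} {P' : Measure Ω'} {X : ι → Ω → ℝ} {Y : ι → Ω' → ℝ}
    (hX : HasGaussianLaw (fun ω i => X i ω) P) (hY : HasGaussianLaw (fun ω i => Y i ω) P')
    (hX0 : ∀ i, ∫ ω, X i ω ∂P = 0) (hY0 : ∀ i, ∫ ω, Y i ω ∂P' = 0)
    (hC : (Matrix.of fun i j => cov[Y i, Y j; P'] - cov[X i, X j; P]).PosSemidef)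
    {f : (ι → ℝ) → ℝ≥0∞} (hf : Measurable f) (hconv : ∀ x z, 2 * f x ≤ f (x + z) + f (x - z)) :
    ∫⁻ ω, f (fun i => X i ω) ∂P ≤ ∫⁻ ω, f (fun i => Y i ω) ∂P' := by
  classical
  have := hX.isProbabilityMeasure
  set C : Matrix ι ι ℝ := Matrix.of fun i j => cov[Y i, Y j; P'] - cov[X i, X j; P] with hCdef
  -- `ζ` is the law of the independent noise that fills the gap between the two covariances; it is
  -- realised on the second factor of `P.prod ζ`.
  set ζ := multivariateGaussian 0 C with hζ
  have hXi : ∀ i, MemLp (fun q : Ω × EuclideanSpace ℝ ι => X i q.1) 2 (P.prod ζ) := fun i =>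
    ((hX.eval i).memLp_two).comp_fst ζ
  have hZ : HasGaussianLaw (fun z : EuclideanSpace ℝ ι => z) ζ := IsGaussian.hasGaussianLaw_id
  have hZi' : ∀ i, MemLp (fun z : EuclideanSpace ℝ ι => z i) 2 ζ := fun i =>
    (hZ.map_fun (EuclideanSpace.proj i)).memLp_two
  have hZi : ∀ i, MemLp (fun q : Ω × EuclideanSpace ℝ ι => q.2 i) 2 (P.prod ζ) := fun i =>
    (hZi' i).comp_snd P
  have hind : IndepFun (fun q : Ω × EuclideanSpace ℝ ι => (fun i => X i q.1))
      (fun q : Ω × EuclideanSpace ℝ ι => q.2) (P.prod ζ) :=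
    indepFun_prod₀ hX.aemeasurable hZ.aemeasurable
  have hG : HasGaussianLaw (fun q : Ω × EuclideanSpace ℝ ι => ((fun i => X i q.1), q.2))
      (P.prod ζ) := by
    refine IndepFun.hasGaussianLaw ?_ ?_ hind
    · constructor
      have h1 := hX.isGaussian_map
      have : (P.prod ζ).map (fun q : Ω × EuclideanSpace ℝ ι => (fun i => X i q.1)) =
          P.map (fun ω i => X i ω) := by
        have := AEMeasurable.map_map_of_aemeasurable (μ := P.prod ζ)
          (f := Prod.fst) (g := fun ω i => X i ω) (by simpa using hX.aemeasurable) (by fun_prop)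
        rw [Measure.map_fst_prod, measure_univ, one_smul] at this
        exact this.symm
      rwa [this]
    · constructor
      have : (P.prod ζ).map (fun q : Ω × EuclideanSpace ℝ ι => q.2) = ζ := by
        simp [Measure.map_snd_prod (μ := P) (ν := ζ)]
      rw [this]; infer_instance
  have hcross : ∀ i j, cov[fun q : Ω × EuclideanSpace ℝ ι => X i q.1, fun q => q.2 j;
      P.prod ζ] = 0 := fun i j =>
    (hind.comp (measurable_pi_apply i) (by fun_prop :
      Measurable fun z : EuclideanSpace ℝ ι => z j)).covariance_eq_zero (hXi i) (hZi j)
  have hcross' : ∀ i j, cov[fun q : Ω × EuclideanSpace ℝ ι => q.2 i, fun q => X j q.1;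
      P.prod ζ] = 0 := fun i j => by rw [covariance_comm]; exact hcross j i
  have hXX : ∀ i j, cov[fun q : Ω × EuclideanSpace ℝ ι => X i q.1, fun q => X j q.1;
      P.prod ζ] = cov[X i, X j; P] := by
    intro i j
    have h := Measure.map_fst_prod (μ := P) (ν := ζ)
    rw [measure_univ, one_smul] at h
    have hm := fun i => (hX.eval i).aemeasurable.aestronglyMeasurable
    conv_rhs => rw [← h]
    rw [covariance_map (by rw [h]; exact hm i) (by rw [h]; exact hm j) (by fun_prop)]
    rfl
  have hZZ : ∀ i j, cov[fun q : Ω × EuclideanSpace ℝ ι => q.2 i, fun q => q.2 j;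
      P.prod ζ] = cov[Y i, Y j; P'] - cov[X i, X j; P] := by
    intro i j
    have h := Measure.map_snd_prod (μ := P) (ν := ζ)
    rw [measure_univ, one_smul] at h
    have hcov := covariance_eval_multivariateGaussian (μ := 0) hC i j
    rw [← hζ, ← h, covariance_map (by fun_prop) (by fun_prop) (by fun_prop)] at hcov
    exact hcov
  have hmX : ∀ i, ∫ q : Ω × EuclideanSpace ℝ ι, X i q.1 ∂(P.prod ζ) = 0 := fun i => by
    simpa [hX0] using integral_fun_fst (μ := P) (ν := ζ) (X i)
  have hmZ : ∀ i, ∫ q : Ω × EuclideanSpace ℝ ι, q.2 i ∂(P.prod ζ) = 0 := fun i => by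
    rw [integral_fun_snd (μ := P) (ν := ζ) (fun z : EuclideanSpace ℝ ι => z i)]
    have h := ContinuousLinearMap.integral_comp_comm (EuclideanSpace.proj i : _ →L[ℝ] ℝ)
      (μ := ζ) (φ := fun z => z) hZ.integrable
    rw [integral_id_multivariateGaussian] at h
    simpa using h
  -- The sign `σ = ±1` does not affect the covariance of `X + σZ`, so both signs reproduce the law
  -- of `Y`.
  have hlaw : ∀ σ : ℝ, σ ^ 2 = 1 → ∫⁻ q : Ω × EuclideanSpace ℝ ι,
      f (fun i => X i q.1 + σ * q.2 i) ∂(P.prod ζ) = ∫⁻ ω, f (fun i => Y i ω) ∂P' := by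
    intro σ hσ
    have hU : HasGaussianLaw (fun (q : Ω × EuclideanSpace ℝ ι) i => X i q.1 + σ * q.2 i)
        (P.prod ζ) :=
      hG.map_fun (ContinuousLinearMap.fst ℝ _ _ +
        σ • ((PiLp.continuousLinearEquiv 2 ℝ (fun _ : ι => ℝ)).toContinuousLinearMap ∘L
          ContinuousLinearMap.snd ℝ (ι → ℝ) (EuclideanSpace ℝ ι)))
    have := map_eq_of_covariance_eq hU hY (fun i => ?_) hY0 (fun i j => ?_)
    · rw [← lintegral_map' hf.aemeasurable hY.aemeasurable, ← this,
        lintegral_map' hf.aemeasurable hU.aemeasurable]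
    · rw [integral_add ((hXi i).integrable (by norm_num))
        (((hZi i).integrable (by norm_num)).const_mul _), integral_const_mul, hmX, hmZ]
      simp
    · change cov[(fun q : Ω × EuclideanSpace ℝ ι => X i q.1) + fun q => σ * q.2 i,
        (fun q : Ω × EuclideanSpace ℝ ι => X j q.1) + fun q => σ * q.2 j; P.prod ζ] = _
      rw [covariance_add_left (hXi i) ((hZi i).const_mul _) ((hXi j).add ((hZi j).const_mul _)),
        covariance_add_right (hXi i) (hXi j) ((hZi j).const_mul _),
        covariance_add_right ((hZi i).const_mul _) (hXi j) ((hZi j).const_mul _)]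
      simp only [covariance_const_mul_left, covariance_const_mul_right, hcross, hcross', hXX, hZZ]
      linear_combination hσ * (cov[Y i, Y j; P'] - cov[X i, X j; P])
  have hfX : AEMeasurable (fun ω => f (fun i => X i ω)) P := hf.comp_aemeasurable hX.aemeasurable
  have key : 2 * ∫⁻ ω, f (fun i => X i ω) ∂P ≤ 2 * ∫⁻ ω, f (fun i => Y i ω) ∂P' := by
    calc 2 * ∫⁻ ω, f (fun i => X i ω) ∂P
        = ∫⁻ q : Ω × EuclideanSpace ℝ ι, 2 * f (fun i => X i q.1) ∂(P.prod ζ) := by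
          rw [lintegral_prod _ (hfX.comp_fst.const_mul 2)]
          simp [lintegral_const_mul'' _ hfX]
      _ ≤ ∫⁻ q : Ω × EuclideanSpace ℝ ι, (f (fun i => X i q.1 + 1 * q.2 i) +
            f (fun i => X i q.1 + (-1) * q.2 i)) ∂(P.prod ζ) := by
          refine lintegral_mono fun q => ?_
          convert hconv (fun i => X i q.1) (fun i => q.2 i) using 3 <;> ext i <;>
            simp [sub_eq_add_neg]
      _ = 2 * ∫⁻ ω, f (fun i => Y i ω) ∂P' := by
          rw [lintegral_add_left', hlaw 1 (by norm_num), hlaw (-1) (by norm_num), two_mul]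
          refine hf.comp_aemeasurable (aemeasurable_pi_lambda _ fun i => ?_)
          exact (hXi i).aestronglyMeasurable.aemeasurable.add (by fun_prop)
  exact (ENNReal.mul_le_mul_iff_right (by norm_num) (by norm_num)).1 key

/-! ### A dimension-free Fernique bound. -/

/-- A Gaussian vector whose sup norm is at most `a` with probability at least `3 / 4` has a first
moment bounded by a constant that depends on `a` only. -/
theorem exists_lintegral_norm_le_of_measure_norm_le {a : ℝ} (ha : 0 < a) :
    ∃ M : ℝ≥0∞, M ≠ ∞ ∧ ∀ {ι : Type} [Fintype ι] (μ : Measure (ι → ℝ)) [IsGaussian μ],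
      ∫ x, id x ∂μ = 0 → 3 / 4 ≤ μ {x | ‖x‖ ≤ a} → ∫⁻ x, ENNReal.ofReal ‖x‖ ∂μ ≤ M := by
  -- Any level strictly between `1/2` and `1` would do: above `1/2` Fernique's estimate applies, and
  -- `c / (1 - c) > 1` makes the series in `B` converge.
  set c : ℝ≥0∞ := 3 / 4 with hc
  have hc1 : c < 1 := by
    rw [hc, ENNReal.div_lt_iff (by norm_num) (by norm_num)]; norm_num
  have hc2 : 2⁻¹ < c := by
    rw [hc, ENNReal.lt_div_iff_mul_lt (by norm_num) (by norm_num)]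
    rw [show (4 : ℝ≥0∞) = 2 * 2 by norm_num, ← mul_assoc,
      ENNReal.inv_mul_cancel (by norm_num) (by norm_num)]
    norm_num
  set B : ℝ≥0∞ := .ofReal (Real.exp (Fernique.logRatio c))
        + ∑' n : ℕ, .ofReal (Real.exp (-2⁻¹ * Real.log (c / (1 - c)).toReal * 2 ^ n)) with hB
  have hBtop : B ≠ ∞ := by
    refine (ENNReal.add_lt_top.mpr ⟨ENNReal.ofReal_lt_top, ?_⟩).ne
    refine Summable.tsum_ofReal_lt_top <|
      Real.summable_exp_nat_mul_of_ge ?_ (fun i ↦ mod_cast (Nat.lt_pow_self (by simp)).le)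
    refine mul_neg_of_neg_of_pos (by simp) (Real.log_pos ?_)
    have h1 : (1 - c).toReal = 1 / 4 := by
      rw [ENNReal.toReal_sub_of_le hc1.le (by simp), hc]
      norm_num
    have h2 : c.toReal = 3 / 4 := by rw [hc]; norm_num
    rw [ENNReal.toReal_div, h1, h2]
    norm_num
  set κ : ℝ := Fernique.logRatio c * a⁻¹ ^ 2 with hκ
  have hκ0 : 0 < κ := mul_pos (Fernique.logRatio_pos hc2 hc1) (by positivity)
  refine ⟨ENNReal.ofReal (1 + κ⁻¹) * B, ENNReal.mul_ne_top (by simp) hBtop, ?_⟩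
  intro ι _ μ _ hμ hμa
  have h1 := lintegral_exp_mul_sq_norm_le_of_map_rotation_eq_self
    (IsGaussian.map_rotation_eq_self hμ (-(Real.pi / 4))) hμa hc2
  refine le_trans ?_ (mul_le_mul_right h1 _)
  rw [← lintegral_const_mul _ (by fun_prop)]
  refine lintegral_mono fun x => ?_
  rw [← ENNReal.ofReal_mul (by positivity)]
  refine ENNReal.ofReal_le_ofReal ?_
  -- The goal follows from `r ≤ 1 + r ^ 2` and `1 + u ≤ exp u` with `r = ‖x‖`, `u = κ * r ^ 2`.
  have h2 := Real.add_one_le_exp (κ * ‖x‖ ^ 2)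
  have h3 : κ⁻¹ * (κ * ‖x‖ ^ 2) = ‖x‖ ^ 2 := by field_simp
  have h4 : 0 < κ⁻¹ := by positivity
  nlinarith [sq_nonneg (‖x‖ - 1), sq_nonneg ‖x‖, mul_le_mul_of_nonneg_left h2 h4.le,
    mul_nonneg hκ0.le (sq_nonneg ‖x‖)]

/-! ### Suprema over compact spaces as limits over finite sets. -/

open Filter Topology

/-- The supremum over the first `n + 1` points of the dense sequence of `S`. -/
noncomputable def denseSup {S : Type*} [TopologicalSpace S] [TopologicalSpace.SeparableSpace S]
    [Nonempty S] (f : S → ℝ) (n : ℕ) : ℝ :=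
  ⨆ i : Fin (n + 1), f (TopologicalSpace.denseSeq S i)

theorem le_ciSup_of_fintype {ι : Type*} [Finite ι] (x : ι → ℝ) (i : ι) : x i ≤ ⨆ i, x i :=
  le_ciSup (Set.finite_range x).bddAbove i

theorem monotone_denseSup {S : Type*} [TopologicalSpace S] [TopologicalSpace.SeparableSpace S]
    [Nonempty S] (f : S → ℝ) : Monotone (denseSup f) := by
  intro m n hmn
  refine ciSup_le fun i => ?_
  exact le_ciSup_of_fintype (fun i : Fin (n + 1) => f (TopologicalSpace.denseSeq S i))
    (Fin.castLE (by omega) i)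

/-- Compactness makes the supremum a genuine least upper bound; sublevel sets of `f` are closed, so
a bound on the dense sequence holds everywhere. -/
theorem tendsto_denseSup {S : Type*} [TopologicalSpace S] [TopologicalSpace.SeparableSpace S]
    [CompactSpace S] [Nonempty S] {f : S → ℝ} (hf : Continuous f) :
    Tendsto (denseSup f) atTop (𝓝 (⨆ s, f s)) := by
  have hb : BddAbove (range f) := (isCompact_range hf).bddAbove
  refine tendsto_atTop_isLUB (monotone_denseSup f) ⟨?_, ?_⟩
  · rintro _ ⟨n, rfl⟩
    exact ciSup_le fun i => le_ciSup hb _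
  · intro b hb'
    refine ciSup_le fun s => ?_
    have hcl : IsClosed {s | f s ≤ b} := isClosed_le hf continuous_const
    have : range (TopologicalSpace.denseSeq S) ⊆ {s | f s ≤ b} := by
      rintro _ ⟨n, rfl⟩
      exact (le_ciSup_of_fintype (fun i : Fin (n + 1) => f (TopologicalSpace.denseSeq S i))
        (Fin.last n)).trans (hb' ⟨n, rfl⟩)
    exact (TopologicalSpace.denseRange_denseSeq S).induction_on (p := fun s => f s ≤ b) s hcl
      fun n => this ⟨n, rfl⟩

theorem IsGaussianProcess.hasGaussianLaw_fintype {Ω S ι : Type*} [MeasurableSpace Ω]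
    [Fintype ι] {P : Measure Ω} {U : S → Ω → ℝ} (hU : IsGaussianProcess U P) (t : ι → S) :
    HasGaussianLaw (fun ω i => U (t i) ω) P :=
  ((hU.comp_right t).hasGaussianLaw Finset.univ).map_fun
    (ContinuousLinearMap.pi fun i : ι => ContinuousLinearMap.proj (⟨i, Finset.mem_univ i⟩ :
      (Finset.univ : Finset ι)))

theorem measurable_iSup_fin (n : ℕ) : Measurable fun x : Fin (n + 1) → ℝ => ⨆ i, x i :=
  Measurable.iSup fun i => measurable_pi_apply i

theorem aemeasurable_denseSup {Ω S : Type*} [MeasurableSpace Ω] [TopologicalSpace S]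
    [TopologicalSpace.SeparableSpace S] [Nonempty S] {P : Measure Ω} {U : S → Ω → ℝ}
    (hU : ∀ s, AEMeasurable (U s) P) (n : ℕ) :
    AEMeasurable (fun ω => denseSup (fun s => U s ω) n) P :=
  (measurable_iSup_fin n).comp_aemeasurable (aemeasurable_pi_lambda _ fun _ => hU _)

theorem aemeasurable_iSup_of_continuous {Ω S : Type*} [MeasurableSpace Ω] [TopologicalSpace S]
    [TopologicalSpace.SeparableSpace S] [CompactSpace S] [Nonempty S] {P : Measure Ω}
    {U : S → Ω → ℝ} (hU : ∀ s, AEMeasurable (U s) P) (hc : ∀ᵐ ω ∂P, Continuous fun s => U s ω) :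
    AEMeasurable (fun ω => ⨆ s, U s ω) P :=
  aemeasurable_of_tendsto_metrizable_ae atTop (aemeasurable_denseSup hU)
    (hc.mono fun _ h => tendsto_denseSup h)

theorem tendsto_lintegral_denseSup {Ω S : Type*} [MeasurableSpace Ω] [TopologicalSpace S]
    [TopologicalSpace.SeparableSpace S] [CompactSpace S] [Nonempty S] {P : Measure Ω}
    {U : S → Ω → ℝ} (hU : ∀ s, AEMeasurable (U s) P) (hc : ∀ᵐ ω ∂P, Continuous fun s => U s ω)
    {φ : ℝ → ℝ≥0∞} (hφ : Monotone φ) (hφc : Continuous φ) :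
    Tendsto (fun n => ∫⁻ ω, φ (denseSup (fun s => U s ω) n) ∂P) atTop
      (𝓝 (∫⁻ ω, φ (⨆ s, U s ω) ∂P)) :=
  lintegral_tendsto_of_tendsto_of_monotone
    (fun n => hφc.measurable.comp_aemeasurable (aemeasurable_denseSup hU n))
    (.of_forall fun _ => hφ.comp (monotone_denseSup _))
    (hc.mono fun _ h => (hφc.tendsto _).comp (tendsto_denseSup h))

/-! ### Gaussian processes with ordered covariances. -/

/-- The covariance kernel of `V` minus the covariance kernel of `U` is positive semidefinite. -/
def CovarianceDominated {Ω Ω' S : Type*} [MeasurableSpace Ω] [MeasurableSpace Ω']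
    (P : Measure Ω) (P' : Measure Ω') (U : S → Ω → ℝ) (V : S → Ω' → ℝ) : Prop :=
  ∀ {ι : Type} [Fintype ι] (t : ι → S) (c : ι → ℝ),
    0 ≤ ∑ i, ∑ j, c i * c j * (cov[V (t i), V (t j); P'] - cov[U (t i), U (t j); P])

theorem CovarianceDominated.posSemidef {Ω Ω' S : Type*} [MeasurableSpace Ω] [MeasurableSpace Ω']
    {P : Measure Ω} {P' : Measure Ω'} {U : S → Ω → ℝ} {V : S → Ω' → ℝ}
    (h : CovarianceDominated P P' U V) {ι : Type} [Fintype ι] (t : ι → S) :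
    (Matrix.of fun i j => cov[V (t i), V (t j); P'] - cov[U (t i), U (t j); P]).PosSemidef := by
  refine Matrix.PosSemidef.of_dotProduct_mulVec_nonneg ?_ fun c => ?_
  · ext i j
    simp [covariance_comm (V (t i)), covariance_comm (U (t i))]
  · refine (h t c).trans_eq ?_
    simp only [dotProduct, Matrix.mulVec, Matrix.of_apply, Finset.mul_sum]
    refine Finset.sum_congr rfl fun i _ => Finset.sum_congr rfl fun j _ => ?_
    simp only [Pi.star_apply, star_trivial]
    ring

/-- Comparison of the suprema of two centered continuous Gaussian processes in the increasing
convex order, when the difference of the covariances is positive semidefinite. -/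
theorem CovarianceDominated.lintegral_iSup_le {Ω Ω' S : Type*} [MeasurableSpace Ω]
    [MeasurableSpace Ω'] [TopologicalSpace S]
    [TopologicalSpace.SeparableSpace S] [CompactSpace S] [Nonempty S]
    {P : Measure Ω} {P' : Measure Ω'} {U : S → Ω → ℝ} {V : S → Ω' → ℝ}
    (h : CovarianceDominated P P' U V)
    (hU : IsGaussianProcess U P) (hV : IsGaussianProcess V P')
    (hU0 : ∀ s, ∫ ω, U s ω ∂P = 0) (hV0 : ∀ s, ∫ ω, V s ω ∂P' = 0)
    (hUc : ∀ᵐ ω ∂P, Continuous fun s => U s ω) (hVc : ∀ᵐ ω ∂P', Continuous fun s => V s ω)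
    {φ : ℝ → ℝ≥0∞} (hφ : Monotone φ) (hφc : Continuous φ)
    (hconv : ∀ a b, 2 * φ ((a + b) / 2) ≤ φ a + φ b) :
    ∫⁻ ω, φ (⨆ s, U s ω) ∂P ≤ ∫⁻ ω, φ (⨆ s, V s ω) ∂P' := by
  refine le_of_tendsto_of_tendsto'
    (tendsto_lintegral_denseSup hU.aemeasurable hUc hφ hφc)
    (tendsto_lintegral_denseSup hV.aemeasurable hVc hφ hφc) fun n => ?_
  let t : Fin (n + 1) → S := fun i => TopologicalSpace.denseSeq S i
  refine lintegral_le_of_covariance_sub_posSemidef (f := fun x => φ (⨆ i, x i))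
    (IsGaussianProcess.hasGaussianLaw_fintype hU t) (IsGaussianProcess.hasGaussianLaw_fintype hV t)
    (fun _ => hU0 _) (fun _ => hV0 _) (h.posSemidef t)
    (hφc.measurable.comp (measurable_iSup_fin n)) fun x z => ?_
  refine le_trans ?_ (hconv _ _)
  gcongr
  -- Each `x i` is the average of `(x + z) i` and `(x - z) i`, hence at most the average of the two
  -- suprema.
  refine hφ (ciSup_le fun i => ?_)
  have h1 := le_ciSup_of_fintype (x + z) i
  have h2 := le_ciSup_of_fintype (x - z) i
  simp only [Pi.add_apply, Pi.sub_apply] at h1 h2 ⊢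
  linarith

/-- The supremum of a centered continuous Gaussian process on a compact space has an integrable
positive part. -/
theorem lintegral_iSup_ne_top {Ω S : Type*} [MeasurableSpace Ω] [TopologicalSpace S]
    [TopologicalSpace.SeparableSpace S] [CompactSpace S] [Nonempty S] {P : Measure Ω}
    {V : S → Ω → ℝ} (hV : IsGaussianProcess V P) (hV0 : ∀ s, ∫ ω, V s ω ∂P = 0)
    (hVc : ∀ᵐ ω ∂P, Continuous fun s => V s ω) :
    ∫⁻ ω, ENNReal.ofReal (⨆ s, V s ω) ∂P ≠ ∞ := by
  have := hV.isProbabilityMeasure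
  -- Continuous paths on a compact space are bounded, so these sets exhaust `Ω` up to a null set.
  -- One `k` with `P (A k) > 3 / 4` then serves every finite subfamily, which gives a bound uniform
  -- in `n`.
  let A : ℕ → Set Ω := fun k => {ω | ∀ s, |V s ω| ≤ k}
  have hA : Monotone A := fun k l hkl ω hω s => (hω s).trans (by exact_mod_cast hkl)
  have hA1 : P (⋃ k, A k) = 1 := by
    have : (⋃ k, A k) =ᵐ[P] univ := by
      rw [eventuallyEq_univ]
      filter_upwards [hVc] with ω hω
      obtain ⟨b, hb⟩ := (isCompact_range hω.abs).bddAbove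
      obtain ⟨k, hk⟩ := exists_nat_ge b
      exact mem_iUnion.2 ⟨k, fun s => (hb ⟨s, rfl⟩).trans hk⟩
    rw [measure_congr this, measure_univ]
  have hlim := tendsto_measure_iUnion_atTop (μ := P) hA
  rw [hA1] at hlim
  obtain ⟨k, hk, hk0⟩ := ((hlim.eventually (lt_mem_nhds (show (3 / 4 : ℝ≥0∞) < 1 by
    rw [ENNReal.div_lt_iff (by norm_num) (by norm_num)]; norm_num))).and
      (eventually_gt_atTop 0)).exists
  obtain ⟨M, hM, hMle⟩ := exists_lintegral_norm_le_of_measure_norm_le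
    (a := k) (by exact_mod_cast hk0)
  refine ne_top_of_le_ne_top hM (le_of_tendsto'
    (tendsto_lintegral_denseSup hV.aemeasurable hVc ENNReal.ofReal_mono
      ENNReal.continuous_ofReal) fun n => ?_)
  let t : Fin (n + 1) → S := fun i => TopologicalSpace.denseSeq S i
  have hG := IsGaussianProcess.hasGaussianLaw_fintype hV t
  have := hG.isGaussian_map
  refine le_trans ?_ (hMle (P.map fun ω i => V (t i) ω)
    (integral_id_map_eq_zero hG fun _ => hV0 _) ?_)
  · rw [lintegral_map' (by fun_prop) hG.aemeasurable]
    refine lintegral_mono fun ω => ENNReal.ofReal_le_ofReal (ciSup_le fun i => ?_)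
    exact (le_abs_self _).trans (norm_le_pi_norm (fun i => V (t i) ω) i)
  · rw [Measure.map_apply_of_aemeasurable hG.aemeasurable
      (measurableSet_le measurable_norm measurable_const)]
    refine hk.le.trans (measure_mono fun ω hω => ?_)
    exact (pi_norm_le_iff_of_nonneg (by positivity)).2 fun i => hω _

/-! ### Positive semidefiniteness of the power kernel. -/

/-- Near `0` the integrand is at most `x * θ ^ (-K)`, integrable since `K < 1`; on `(1, ∞)` it is at
most `θ ^ (-1 - K)`, integrable since `K > 0`. -/
theorem integrableOn_one_sub_exp_mul_rpow {K x : ℝ} (hK0 : 0 < K) (hK1 : K < 1) (hx : 0 ≤ x) :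
    IntegrableOn (fun θ : ℝ => (1 - Real.exp (-(x * θ))) * θ ^ (-1 - K)) (Ioi 0) := by
  have hm : ∀ s : Set ℝ, AEStronglyMeasurable
      (fun θ : ℝ => (1 - Real.exp (-(x * θ))) * θ ^ (-1 - K)) (volume.restrict s) :=
    fun s => Measurable.aestronglyMeasurable (by fun_prop)
  rw [← Ioc_union_Ioi_eq_Ioi zero_le_one]
  refine IntegrableOn.union ?_ ?_
  · have h1 : IntegrableOn (fun θ : ℝ => x * θ ^ (-K)) (Ioc 0 1) := by
      refine Integrable.const_mul ?_ _
      rw [← IntegrableOn, ← intervalIntegrable_iff_integrableOn_Ioc_of_le zero_le_one]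
      exact intervalIntegral.intervalIntegrable_rpow' (by linarith)
    refine h1.mono' (hm _) ?_
    filter_upwards [ae_restrict_mem measurableSet_Ioc] with θ hθ
    have h2 : 0 ≤ 1 - Real.exp (-(x * θ)) := by
      have := Real.exp_le_one_iff.2 (neg_nonpos.2 (mul_nonneg hx hθ.1.le)); linarith
    have h3 : 1 - Real.exp (-(x * θ)) ≤ x * θ := by
      have := Real.add_one_le_exp (-(x * θ)); linarith
    rw [Real.norm_of_nonneg (mul_nonneg h2 (Real.rpow_nonneg hθ.1.le _))]
    calc _ ≤ x * θ * θ ^ (-1 - K) :=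
          mul_le_mul_of_nonneg_right h3 (Real.rpow_nonneg hθ.1.le _)
      _ = x * θ ^ (-K) := by
          rw [show -K = 1 + (-1 - K) by ring, Real.rpow_add hθ.1, Real.rpow_one]; ring
  · have h1 : IntegrableOn (fun θ : ℝ => θ ^ (-1 - K)) (Ioi 1) :=
      integrableOn_Ioi_rpow_of_lt (by linarith) zero_lt_one
    refine h1.mono' (hm _) ?_
    filter_upwards [ae_restrict_mem measurableSet_Ioi] with θ hθ
    have hθ0 : (0 : ℝ) < θ := zero_lt_one.trans hθ
    have h2 : 0 ≤ 1 - Real.exp (-(x * θ)) := by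
      have := Real.exp_le_one_iff.2 (neg_nonpos.2 (mul_nonneg hx hθ0.le)); linarith
    rw [Real.norm_of_nonneg (mul_nonneg h2 (Real.rpow_nonneg hθ0.le _))]
    have := Real.exp_pos (-(x * θ))
    exact mul_le_of_le_one_left (Real.rpow_nonneg hθ0.le _) (by linarith)

/-- Substitute `xθ` for `θ`. -/
theorem integral_one_sub_exp_mul_rpow {K x : ℝ} (hK0 : 0 < K) (hx : 0 ≤ x) :
    ∫ θ in Ioi (0 : ℝ), (1 - Real.exp (-(x * θ))) * θ ^ (-1 - K) =
      x ^ K * ∫ θ in Ioi (0 : ℝ), (1 - Real.exp (-θ)) * θ ^ (-1 - K) := by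
  rcases hx.eq_or_lt with rfl | hx
  · simp [Real.zero_rpow hK0.ne']
  have h := integral_comp_mul_left_Ioi
    (fun θ : ℝ => (1 - Real.exp (-θ)) * θ ^ (-1 - K)) 0 hx
  rw [mul_zero, smul_eq_mul] at h
  have h2 : ∫ θ in Ioi (0 : ℝ), (1 - Real.exp (-(x * θ))) * (x * θ) ^ (-1 - K) =
      x ^ (-1 - K) * ∫ θ in Ioi (0 : ℝ), (1 - Real.exp (-(x * θ))) * θ ^ (-1 - K) := by
    rw [← integral_const_mul]
    refine setIntegral_congr_fun measurableSet_Ioi fun θ hθ => ?_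
    rw [Real.mul_rpow hx.le (le_of_lt hθ)]; ring
  rw [h2] at h
  have h3 : x ^ (K + 1) * x ^ (-1 - K) = 1 := by
    rw [← Real.rpow_add hx, show K + 1 + (-1 - K) = 0 by ring, Real.rpow_zero]
  have h4 : x ^ (K + 1) * x⁻¹ = x ^ K := by
    rw [Real.rpow_add hx, Real.rpow_one]; field_simp
  calc _ = x ^ (K + 1) * x ^ (-1 - K) *
        ∫ θ in Ioi (0 : ℝ), (1 - Real.exp (-(x * θ))) * θ ^ (-1 - K) := by rw [h3, one_mul]
    _ = _ := by rw [mul_assoc, h, ← mul_assoc, h4]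

theorem integral_one_sub_exp_mul_rpow_pos {K : ℝ} (hK0 : 0 < K) (hK1 : K < 1) :
    0 < ∫ θ in Ioi (0 : ℝ), (1 - Real.exp (-θ)) * θ ^ (-1 - K) := by
  have hi := integrableOn_one_sub_exp_mul_rpow hK0 hK1 zero_le_one
  simp only [one_mul] at hi
  have hpos : ∀ θ ∈ Ioi (0 : ℝ), 0 < (1 - Real.exp (-θ)) * θ ^ (-1 - K) := fun θ hθ =>
    mul_pos (by have := Real.exp_lt_one_iff.2 (neg_lt_zero.2 hθ); linarith)
      (Real.rpow_pos_of_pos hθ _)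
  rw [setIntegral_pos_iff_support_of_nonneg_ae _ hi]
  · have : Ioi (0 : ℝ) ⊆
        Function.support (fun θ : ℝ => (1 - Real.exp (-θ)) * θ ^ (-1 - K)) ∩ Ioi 0 :=
      fun θ hθ => ⟨(hpos θ hθ).ne', hθ⟩
    exact lt_of_lt_of_le (by simp) (measure_mono this)
  · filter_upwards [ae_restrict_mem measurableSet_Ioi] with θ hθ using (hpos θ hθ).le

/-- For `0 < K ≤ 1` the kernel `x ^ K + y ^ K - (x + y) ^ K` on `[0, ∞)` is positive
semidefinite. -/
theorem sum_sum_rpow_add_rpow_sub_nonneg {ι : Type*} [Fintype ι] {K : ℝ} (hK0 : 0 < K)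
    (hK1 : K ≤ 1) (x c : ι → ℝ) (hx : ∀ i, 0 ≤ x i) :
    0 ≤ ∑ i, ∑ j, c i * c j * (x i ^ K + x j ^ K - (x i + x j) ^ K) := by
  -- For `K = 1` the kernel is zero, while the integral representation diverges at `θ = 0`.
  rcases hK1.eq_or_lt with rfl | hK1
  · simp
  have hI := integral_one_sub_exp_mul_rpow_pos hK0 hK1
  set I := ∫ θ in Ioi (0 : ℝ), (1 - Real.exp (-θ)) * θ ^ (-1 - K) with hIdef
  refine nonneg_of_mul_nonneg_left (b := I) ?_ hI
  have hint : ∀ y, 0 ≤ y →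
      IntegrableOn (fun θ : ℝ => (1 - Real.exp (-(y * θ))) * θ ^ (-1 - K)) (Ioi 0) :=
    fun y hy => integrableOn_one_sub_exp_mul_rpow hK0 hK1 hy
  have key : (∑ i, ∑ j, c i * c j * (x i ^ K + x j ^ K - (x i + x j) ^ K)) * I =
      ∫ θ in Ioi (0 : ℝ), (∑ i, c i * (1 - Real.exp (-(x i * θ)))) ^ 2 * θ ^ (-1 - K) := by
    have h1 : ∀ i j, c i * c j * (x i ^ K + x j ^ K - (x i + x j) ^ K) * I =
        ∫ θ in Ioi (0 : ℝ), c i * c j * ((1 - Real.exp (-(x i * θ))) * θ ^ (-1 - K) +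
          (1 - Real.exp (-(x j * θ))) * θ ^ (-1 - K) -
          (1 - Real.exp (-((x i + x j) * θ))) * θ ^ (-1 - K)) := by
      intro i j
      have hij := add_nonneg (hx i) (hx j)
      have hadd : IntegrableOn (fun θ : ℝ => (1 - Real.exp (-(x i * θ))) * θ ^ (-1 - K) +
          (1 - Real.exp (-(x j * θ))) * θ ^ (-1 - K)) (Ioi 0) :=
        (hint _ (hx i)).add (hint _ (hx j))
      rw [integral_const_mul, integral_sub hadd (hint _ hij),
        integral_add (hint _ (hx i)) (hint _ (hx j)), integral_one_sub_exp_mul_rpow hK0 (hx i),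
        integral_one_sub_exp_mul_rpow hK0 (hx j), integral_one_sub_exp_mul_rpow hK0 hij]
      ring
    have h2 : ∀ i j, IntegrableOn (fun θ : ℝ => c i * c j *
          ((1 - Real.exp (-(x i * θ))) * θ ^ (-1 - K) +
          (1 - Real.exp (-(x j * θ))) * θ ^ (-1 - K) -
          (1 - Real.exp (-((x i + x j) * θ))) * θ ^ (-1 - K))) (Ioi 0) := fun i j =>
      (((hint _ (hx i)).add (hint _ (hx j))).sub (hint _ (add_nonneg (hx i) (hx j)))).const_mul _
    simp only [Finset.sum_mul, h1]
    simp_rw [← integral_finsetSum _ fun j _ => h2 _ j]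
    rw [← integral_finsetSum _ fun i _ => integrable_finsetSum _ fun j _ => h2 i j]
    refine integral_congr_ae (.of_forall fun θ => ?_)
    simp only [sq, Finset.sum_mul_sum]
    simp only [Finset.sum_mul]
    refine Finset.sum_congr rfl fun i _ => Finset.sum_congr rfl fun j _ => ?_
    rw [show -((x i + x j) * θ) = -(x i * θ) + -(x j * θ) by ring, Real.exp_add]
    ring
  rw [key]
  exact setIntegral_nonneg measurableSet_Ioi fun θ hθ =>
    mul_nonneg (sq_nonneg _) (Real.rpow_nonneg (le_of_lt hθ) _)

/-! ### Expectations in the extended reals. -/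

theorem hasExtExpectation_of_le {Ω : Type*} [MeasurableSpace Ω] {P : Measure Ω}
    [IsFiniteMeasure P] {F : Ω → ℝ} {c : ℝ} (hF : AEMeasurable F P) (hc : ∀ ω, c ≤ F ω) :
    HasExtExpectation P F := by
  refine ⟨hF, Or.inr ?_⟩
  refine ne_top_of_le_ne_top (b := ∫⁻ _, ENNReal.ofReal (-c) ∂P) ?_
    (lintegral_mono fun ω => ENNReal.ofReal_le_ofReal (neg_le_neg (hc ω)))
  rw [lintegral_const]
  exact ENNReal.mul_ne_top ENNReal.ofReal_ne_top (measure_ne_top _ _)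

theorem extExpectation_eq_integral {Ω : Type*} [MeasurableSpace Ω] {P : Measure Ω} {F : Ω → ℝ}
    (hF : Integrable F P) : extExpectation P F = ((∫ ω, F ω ∂P : ℝ) : EReal) := by
  have h1 := hF.lintegral_lt_top.ne
  have h2 : ∫⁻ ω, ENNReal.ofReal (-F ω) ∂P ≠ ∞ := hF.neg.lintegral_lt_top.ne
  rw [extExpectation, integral_eq_lintegral_pos_part_sub_lintegral_neg_part hF, EReal.coe_sub,
    EReal.coe_ennreal_toReal h1, EReal.coe_ennreal_toReal h2]

/-- Extended expectations of functions bounded below by `c` are compared by comparing the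
Lebesgue integrals of the functions minus `c`. -/
theorem extExpectation_le_of_lintegral_sub_le {Ω Ω' : Type*} [MeasurableSpace Ω]
    [MeasurableSpace Ω'] {P : Measure Ω} [IsProbabilityMeasure P] {P' : Measure Ω'}
    [IsProbabilityMeasure P'] {F : Ω → ℝ} {G : Ω' → ℝ} {c : ℝ}
    (hF : AEMeasurable F P) (hG : AEMeasurable G P') (hFc : ∀ ω, c ≤ F ω) (hGc : ∀ ω, c ≤ G ω)
    (h : ∫⁻ ω, ENNReal.ofReal (F ω - c) ∂P ≤ ∫⁻ ω, ENNReal.ofReal (G ω - c) ∂P') :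
    extExpectation P F ≤ extExpectation P' G := by
  by_cases htop : ∫⁻ ω, ENNReal.ofReal (G ω - c) ∂P' = ∞
  -- Here `G` has infinite positive part and finite negative part, so the right-hand side is `⊤`.
  · have hpos : ∫⁻ ω, ENNReal.ofReal (G ω) ∂P' = ∞ := by
      by_contra hne
      refine absurd htop (ne_top_of_le_ne_top
        (b := ∫⁻ ω, (ENNReal.ofReal (G ω) + ENNReal.ofReal (-c)) ∂P') ?_
        (lintegral_mono fun ω => ?_))
      · rw [lintegral_add_right _ measurable_const]
        simp [hne]
      · rw [sub_eq_add_neg]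
        exact ENNReal.ofReal_add_le
    have hneg : ∫⁻ ω, ENNReal.ofReal (-G ω) ∂P' ≠ ∞ := by
      rcases (hasExtExpectation_of_le hG hGc).2 with h' | h'
      · exact absurd hpos h'
      · exact h'
    have : extExpectation P' G = ⊤ := by
      rw [extExpectation, hpos, EReal.coe_ennreal_top]
      lift (∫⁻ ω, ENNReal.ofReal (-G ω) ∂P') to NNReal using hneg with r
      exact EReal.top_sub_coe (r : ℝ)
    rw [this]; exact le_top
  · have hFi : Integrable (fun ω => F ω - c) P := by
      refine ⟨(hF.sub_const c).aestronglyMeasurable, ?_⟩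
      rw [hasFiniteIntegral_iff_ofReal (.of_forall fun ω => sub_nonneg.2 (hFc ω))]
      exact lt_top_iff_ne_top.2 (ne_top_of_le_ne_top htop h)
    have hGi : Integrable (fun ω => G ω - c) P' := by
      refine ⟨(hG.sub_const c).aestronglyMeasurable, ?_⟩
      rw [hasFiniteIntegral_iff_ofReal (.of_forall fun ω => sub_nonneg.2 (hGc ω))]
      exact lt_top_iff_ne_top.2 htop
    have hle : ∫ ω, (F ω - c) ∂P ≤ ∫ ω, (G ω - c) ∂P' := by
      rw [integral_eq_lintegral_of_nonneg_ae (.of_forall fun ω => sub_nonneg.2 (hFc ω)) hFi.1,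
        integral_eq_lintegral_of_nonneg_ae (.of_forall fun ω => sub_nonneg.2 (hGc ω)) hGi.1]
      exact ENNReal.toReal_mono htop h
    have hF' : Integrable F P := (hFi.add (integrable_const c)).congr (.of_forall fun ω => by simp)
    have hG' : Integrable G P' := (hGi.add (integrable_const c)).congr (.of_forall fun ω => by simp)
    rw [extExpectation_eq_integral hF', extExpectation_eq_integral hG', EReal.coe_le_coe_iff]
    rw [integral_sub hF' (integrable_const c), integral_sub hG' (integrable_const c)] at hle
    simpa using hle

/-! ### Convex functions on the half-line and increment processes. -/

theorem convexOn_comp_max_zero {g : ℝ → ℝ} (hm : MonotoneOn g (Ici 0))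
    (hc : ConvexOn ℝ (Ici 0) g) : ConvexOn ℝ univ fun x => g (max x 0) := by
  refine ⟨convex_univ, fun x _ y _ a b ha hb hab => ?_⟩
  simp only [smul_eq_mul]
  have hx : (0 : ℝ) ≤ max x 0 := le_max_right _ _
  have hy : (0 : ℝ) ≤ max y 0 := le_max_right _ _
  have h0 : 0 ≤ a * max x 0 + b * max y 0 := by positivity
  refine (hm (mem_Ici.2 (le_max_right _ _)) (mem_Ici.2 h0) (max_le ?_ h0)).trans
    (hc.2 hx hy ha hb hab)
  gcongr <;> exact le_max_left _ _

theorem supIncrement_nonneg {Ω : Type*} {T : ℝ} (X : Icc (0 : ℝ) T → Ω → ℝ) (ω : Ω) :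
    0 ≤ supIncrement X ω := by
  rw [supIncrement]
  by_cases hb : BddAbove (range fun p : Icc (0 : ℝ) T × Icc (0 : ℝ) T => X p.1 ω - X p.2 ω)
  · rcases isEmpty_or_nonempty (Icc (0 : ℝ) T) with h | ⟨⟨t⟩⟩
    · simp
    · simpa using le_ciSup hb (t, t)
  -- An unbounded real supremum has the default value `0`, so the bound holds for every path,
  -- continuous or not.
  · rw [Real.iSup_of_not_bddAbove hb]

/-- The process of increments of a process. -/
def incrementProcess {Ω S : Type*} (U : S → Ω → ℝ) : S × S → Ω → ℝ :=
  fun p ω => U p.1 ω - U p.2 ω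

theorem isGaussianProcess_incrementProcess {Ω S : Type*} [MeasurableSpace Ω] {P : Measure Ω}
    {U : S → Ω → ℝ} (hU : IsGaussianProcess U P) : IsGaussianProcess (incrementProcess U) P := by
  classical
  exact hU.of_isGaussianProcess fun p => ⟨{p.1, p.2},
    (ContinuousLinearMap.proj (⟨p.1, by simp⟩ : ({p.1, p.2} : Finset S)) :
      (({p.1, p.2} : Finset S) → ℝ) →L[ℝ] ℝ) -
      ContinuousLinearMap.proj (⟨p.2, by simp⟩ : ({p.1, p.2} : Finset S)), fun ω => by
        simp [incrementProcess]⟩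

theorem integral_incrementProcess {Ω S : Type*} [MeasurableSpace Ω] {P : Measure Ω}
    {U : S → Ω → ℝ} (hU : IsGaussianProcess U P) (hU0 : ∀ s, ∫ ω, U s ω ∂P = 0) (p : S × S) :
    ∫ ω, incrementProcess U p ω ∂P = 0 := by
  simp only [incrementProcess]
  rw [integral_sub (hU.hasGaussianLaw_eval _).integrable (hU.hasGaussianLaw_eval _).integrable,
    hU0, hU0, sub_zero]

theorem covariance_incrementProcess {Ω S : Type*} [MeasurableSpace Ω] {P : Measure Ω}
    {U : S → Ω → ℝ} (hU : IsGaussianProcess U P) (p q : S × S) :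
    cov[incrementProcess U p, incrementProcess U q; P] =
      cov[U p.1, U q.1; P] - cov[U p.1, U q.2; P] - cov[U p.2, U q.1; P] +
        cov[U p.2, U q.2; P] := by
  have := hU.isProbabilityMeasure
  have h2 : ∀ s, MemLp (U s) 2 P := fun s => (hU.hasGaussianLaw_eval s).memLp_two
  change cov[U p.1 - U p.2, U q.1 - U q.2; P] = _
  rw [covariance_sub_left (h2 _) (h2 _) ((h2 _).sub (h2 _)),
    covariance_sub_right (h2 _) (h2 _) (h2 _), covariance_sub_right (h2 _) (h2 _) (h2 _)]
  ring

theorem CovarianceDominated.incrementProcess {Ω Ω' S : Type*} [MeasurableSpace Ω]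
    [MeasurableSpace Ω'] {P : Measure Ω} {P' : Measure Ω'} {U : S → Ω → ℝ} {V : S → Ω' → ℝ}
    (h : CovarianceDominated P P' U V) (hU : IsGaussianProcess U P)
    (hV : IsGaussianProcess V P') :
    CovarianceDominated P P' (incrementProcess U) (incrementProcess V) := by
  intro ι _ t c
  -- A combination of increments with weights `c` is a combination of values with weights `c` at the
  -- first times and `-c` at the second.
  refine (h (Sum.elim (fun i => (t i).1) fun i => (t i).2) (Sum.elim c fun i => -c i)).trans_eq ?_
  simp only [Fintype.sum_sum_type, Sum.elim_inl, Sum.elim_inr, ← Finset.sum_add_distrib,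
    covariance_incrementProcess hU, covariance_incrementProcess hV]
  refine Finset.sum_congr rfl fun i _ => Finset.sum_congr rfl fun j _ => ?_
  ring

/-- A centered variable of zero variance vanishes almost surely, and the supremum dominates the
value at `s`. -/
theorem ae_iSup_nonneg_of_covariance_self_eq_zero {Ω S : Type*} [MeasurableSpace Ω]
    [TopologicalSpace S] [CompactSpace S] {P : Measure Ω} {U : S → Ω → ℝ}
    (hU : IsGaussianProcess U P) (hU0 : ∀ s, ∫ ω, U s ω ∂P = 0)
    (hc : ∀ᵐ ω ∂P, Continuous fun s => U s ω) {s : S} (hs : cov[U s, U s; P] = 0) :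
    0 ≤ᵐ[P] fun ω => ⨆ s, U s ω := by
  have := hU.isProbabilityMeasure
  have hm := (hU.hasGaussianLaw_eval s).memLp_two
  rw [covariance_self hm.aemeasurable] at hs
  filter_upwards [hc, ae_eq_integral_of_variance_eq_zero hm hs] with ω h1 h2
  rw [hU0] at h2
  exact h2.symm.le.trans (le_ciSup (isCompact_range h1).bddAbove s)

theorem integrable_and_integral_le_of_lintegral_le {Ω Ω' : Type*} [MeasurableSpace Ω]
    [MeasurableSpace Ω'] {P : Measure Ω} {P' : Measure Ω'} {F : Ω → ℝ} {G : Ω' → ℝ}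
    (hF : AEMeasurable F P) (hG : AEMeasurable G P') (hF0 : 0 ≤ᵐ[P] F) (hG0 : 0 ≤ᵐ[P'] G)
    (hfin : ∫⁻ ω, ENNReal.ofReal (G ω) ∂P' ≠ ∞)
    (h : ∫⁻ ω, ENNReal.ofReal (F ω) ∂P ≤ ∫⁻ ω, ENNReal.ofReal (G ω) ∂P') :
    Integrable F P ∧ Integrable G P' ∧ ∫ ω, F ω ∂P ≤ ∫ ω, G ω ∂P' := by
  refine ⟨⟨hF.aestronglyMeasurable, ?_⟩, ⟨hG.aestronglyMeasurable, ?_⟩, ?_⟩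
  · rw [hasFiniteIntegral_iff_ofReal hF0]
    exact h.trans_lt (lt_top_iff_ne_top.2 hfin)
  · rw [hasFiniteIntegral_iff_ofReal hG0]
    exact lt_top_iff_ne_top.2 hfin
  · rw [integral_eq_lintegral_of_nonneg_ae hF0 hF.aestronglyMeasurable,
      integral_eq_lintegral_of_nonneg_ae hG0 hG.aestronglyMeasurable]
    exact ENNReal.toReal_mono hfin h

/-! ### Bifractional against scaled fractional Brownian motion. -/

theorem covariance_scaledProcess {Ω : Type*} [MeasurableSpace Ω] {P : Measure Ω} {H K T : ℝ}
    {B : Icc (0 : ℝ) T → Ω → ℝ} (hB : IsFractionalBM P (H * K) T B) (s t : Icc (0 : ℝ) T) :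
    cov[scaledProcess K B s, scaledProcess K B t; P] =
      1 / 2 ^ K * ((t : ℝ) ^ (2 * H * K) + (s : ℝ) ^ (2 * H * K) -
        |(t : ℝ) - s| ^ (2 * H * K)) := by
  -- The scaling factor is chosen so that its square times `1 / 2` is the bifractional normalisation
  -- `2 ^ (-K)`.
  have h : (2 : ℝ) ^ ((1 - K) / 2) * 2 ^ ((1 - K) / 2) * (1 / 2) = 1 / 2 ^ K := by
    rw [← Real.rpow_add two_pos, show (1 - K) / 2 + (1 - K) / 2 = 1 - K by ring,
      Real.rpow_sub two_pos, Real.rpow_one]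
    ring
  change cov[fun ω => 2 ^ ((1 - K) / 2) * B s ω, fun ω => 2 ^ ((1 - K) / 2) * B t ω; P] = _
  rw [covariance_const_mul_left, covariance_const_mul_right, hB.covariance_eq, fbmCov, ← h,
    ← mul_assoc 2 H K]
  ring

theorem covarianceDominated_bifractional {Ω Ω' : Type*} [MeasurableSpace Ω] [MeasurableSpace Ω']
    {P : Measure Ω} {P' : Measure Ω'} {H K T : ℝ} (hK0 : 0 < K) (hK1 : K ≤ 1)
    {W : Icc (0 : ℝ) T → Ω → ℝ} (hW : IsBifractionalBM P H K T W)
    {B : Icc (0 : ℝ) T → Ω' → ℝ} (hB : IsFractionalBM P' (H * K) T B) :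
    CovarianceDominated P P' W (scaledProcess K B) := by
  intro ι _ t c
  have h := sum_sum_rpow_add_rpow_sub_nonneg hK0 hK1 (fun i => (t i : ℝ) ^ (2 * H)) c
    (fun i => Real.rpow_nonneg (t i).2.1 _)
  refine (mul_nonneg (by positivity : (0 : ℝ) ≤ 1 / 2 ^ K) h).trans_eq ?_
  simp only [Finset.mul_sum]
  refine Finset.sum_congr rfl fun i _ => Finset.sum_congr rfl fun j _ => ?_
  rw [covariance_scaledProcess hB, hW.covariance_eq, bifbmCov, ← Real.rpow_mul (t i).2.1,
    ← Real.rpow_mul (t j).2.1, abs_sub_comm (t j : ℝ), add_comm ((t j : ℝ) ^ (2 * H))]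
  ring

theorem theorem2p5 {Ω Ω' : Type*} [MeasurableSpace Ω] [MeasurableSpace Ω']
    (P : Measure Ω) [IsProbabilityMeasure P] (P' : Measure Ω') [IsProbabilityMeasure P']
    (H K T : ℝ) (hH0 : 0 < H) (hH1 : H < 1) (hK0 : 0 < K) (hK1 : K ≤ 1) (hT : 0 < T)
    (W : Icc (0 : ℝ) T → Ω → ℝ) (hW : IsBifractionalBM P H K T W)
    (hWc : HasContinuousPaths P W)
    (B : Icc (0 : ℝ) T → Ω' → ℝ) (hB : IsFractionalBM P' (H * K) T B)
    (hBc : HasContinuousPaths P' B) :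
    (∀ g : ℝ → ℝ, MonotoneOn g (Ici 0) → ConvexOn ℝ (Ici 0) g →
      HasExtExpectation P (fun ω => g (supIncrement W ω)) ∧
      HasExtExpectation P' (fun ω => g (supIncrement (scaledProcess K B) ω)) ∧
      extExpectation P (fun ω => g (supIncrement W ω)) ≤
        extExpectation P' (fun ω => g (supIncrement (scaledProcess K B) ω))) ∧
    (Integrable (supProcess W) P ∧ Integrable (supProcess (scaledProcess K B)) P' ∧
      ∫ ω, supProcess W ω ∂P ≤ ∫ ω, supProcess (scaledProcess K B) ω ∂P') := by
  have : Nonempty (Icc (0 : ℝ) T) := ⟨⟨0, le_rfl, hT.le⟩⟩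
  set Y := scaledProcess K B with hYdef
  have hY : IsGaussianProcess Y P' := hB.gaussian.smul fun _ => (2 : ℝ) ^ ((1 - K) / 2)
  have hY0 : ∀ t, ∫ ω, Y t ω ∂P' = 0 := fun t => by
    simp only [hYdef, scaledProcess]
    rw [integral_const_mul, hB.centered, mul_zero]
  have hYc : ∀ᵐ ω ∂P', Continuous fun t => Y t ω := hBc.mono fun _ h => h.const_mul _
  have hdom : CovarianceDominated P P' W Y := covarianceDominated_bifractional hK0 hK1 hW hB
  refine ⟨fun g hgm hgc => ?_, ?_⟩
  · have hconv := convexOn_comp_max_zero hgm hgc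
    have hmono : Monotone fun x => g (max x 0) := fun x y hxy =>
      hgm (mem_Ici.2 (le_max_right _ _)) (mem_Ici.2 (le_max_right _ _)) (max_le_max_right 0 hxy)
    have hcont : Continuous fun x => g (max x 0) :=
      continuousOn_univ.1 (hconv.continuousOn isOpen_univ)
    have hg0 : ∀ x, g 0 ≤ g (max x 0) := fun x =>
      hgm self_mem_Ici (mem_Ici.2 (le_max_right _ _)) (le_max_right _ _)
    have hWi : ∀ᵐ ω ∂P, Continuous fun p => incrementProcess W p ω := hWc.mono fun _ h =>
      (h.comp continuous_fst).sub (h.comp continuous_snd)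
    have hYi : ∀ᵐ ω ∂P', Continuous fun p => incrementProcess Y p ω := hYc.mono fun _ h =>
      (h.comp continuous_fst).sub (h.comp continuous_snd)
    have hWG := isGaussianProcess_incrementProcess hW.gaussian
    have hYG := isGaussianProcess_incrementProcess hY
    -- Replacing `g` by `g (max · 0)` gives a function convex on all of `ℝ`, hence continuous, even
    -- where `g` itself is uncontrolled on negative numbers.
    have hgW : (fun ω => g (supIncrement W ω)) = fun ω => g (max (supIncrement W ω) 0) :=
      funext fun ω => by rw [max_eq_left (supIncrement_nonneg W ω)]
    have hgY : (fun ω => g (supIncrement Y ω)) = fun ω => g (max (supIncrement Y ω) 0) :=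
      funext fun ω => by rw [max_eq_left (supIncrement_nonneg Y ω)]
    have hmW : AEMeasurable (fun ω => g (max (supIncrement W ω) 0)) P :=
      hcont.measurable.comp_aemeasurable (aemeasurable_iSup_of_continuous hWG.aemeasurable hWi)
    have hmY : AEMeasurable (fun ω => g (max (supIncrement Y ω) 0)) P' :=
      hcont.measurable.comp_aemeasurable (aemeasurable_iSup_of_continuous hYG.aemeasurable hYi)
    rw [hgW, hgY]
    refine ⟨hasExtExpectation_of_le hmW fun _ => hg0 _, hasExtExpectation_of_le hmY fun _ => hg0 _,
      extExpectation_le_of_lintegral_sub_le hmW hmY (fun _ => hg0 _) (fun _ => hg0 _) ?_⟩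
    refine CovarianceDominated.lintegral_iSup_le (hdom.incrementProcess hW.gaussian hY) hWG hYG
      (integral_incrementProcess hW.gaussian hW.centered) (integral_incrementProcess hY hY0)
      -- Subtracting the minimum `g 0` makes the test function nonnegative, so that `ENNReal.ofReal`
      -- loses nothing.
      hWi hYi (φ := fun x => ENNReal.ofReal (g (max x 0) - g 0))
      (fun x y hxy => ENNReal.ofReal_le_ofReal (sub_le_sub_right (hmono hxy) _))
      (ENNReal.continuous_ofReal.comp (hcont.sub continuous_const)) fun a b => ?_
    rw [← ENNReal.ofReal_add (sub_nonneg.2 (hg0 a)) (sub_nonneg.2 (hg0 b)),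
      ← ENNReal.ofReal_ofNat 2, ← ENNReal.ofReal_mul zero_le_two]
    refine ENNReal.ofReal_le_ofReal ?_
    have := hconv.2 (mem_univ a) (mem_univ b) (by norm_num : (0 : ℝ) ≤ 1 / 2)
      (by norm_num : (0 : ℝ) ≤ 1 / 2) (by norm_num)
    simp only [smul_eq_mul] at this
    rw [show (a + b) / 2 = 1 / 2 * a + 1 / 2 * b by ring]
    linarith
  · have hHK : 2 * H * K ≠ 0 := by positivity
    refine integrable_and_integral_le_of_lintegral_le
      (aemeasurable_iSup_of_continuous hW.gaussian.aemeasurable hWc)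
      (aemeasurable_iSup_of_continuous hY.aemeasurable hYc)
      (ae_iSup_nonneg_of_covariance_self_eq_zero hW.gaussian hW.centered hWc
        (s := ⟨0, le_rfl, hT.le⟩) ?_)
      (ae_iSup_nonneg_of_covariance_self_eq_zero hY hY0 hYc (s := ⟨0, le_rfl, hT.le⟩) ?_)
      (lintegral_iSup_ne_top hY hY0 hYc)
      (hdom.lintegral_iSup_le hW.gaussian hY hW.centered hY0 hWc hYc ENNReal.ofReal_mono
        ENNReal.continuous_ofReal fun a b => ?_)
    · rw [hW.covariance_eq, bifbmCov]
      simp [Real.zero_rpow hHK, Real.zero_rpow hK0.ne', hH0.ne']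
    · rw [covariance_scaledProcess hB]
      simp [Real.zero_rpow hHK]
    · rw [← ENNReal.ofReal_ofNat 2, ← ENNReal.ofReal_mul zero_le_two,
        mul_div_cancel₀ _ (two_ne_zero' ℝ)]
      exact ENNReal.ofReal_add_le
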